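/- All rings are commutative and contain $\mathbb Q$; a ring extension is an injective ring homomorphism, and $\mathcal K(A)$ denotes the fraction field of a domain $A$. Definitions. An ideal $I$ of a domain $A$ is *central* if for all $a\in A$ and every (finite) sum of squares $b$ of elements of $\mathcal K(A)$, $a^2+b\in I$ implies $a\in I$; the central spectrum of $A$ is the set of its central prime ideals. An extension $A\to C$ of domains is *centrally subintegral* if it is integral, the contraction $\mathfrak q\mapsto\mathfrak q\cap A$ is a bijection from the central spectrum of $C$ onto that of $A$, and for every central prime $\mathfrak q$ of $C$ the residue field extension $k(\mathfrak q\cap A)\to k(\mathfrak q)$ is an isomorphism. For an extension $A\to B$ of domains, the *central seminormalization* $A^{s_c,*}_B$ of $A$ in $B$ is, if it exists, the unique maximal element among the intermediate rings $A\subset C\subset B$ such that $A\to C$ is centrally subintegral. A domain $D$ is *Japanese* if for every finite field extension $L$ of $\mathcal K(D)$ the integral closure of $D$ in $L$ is a finite $D$-module; a ring $A$ is a *Nagata ring* if it is Noetherian and $A/\mathfrak p$ is Japanese for every prime ideal $\mathfrak p$. An extension $A\to B$ is *essentially of finite type* if $B$ is a localization of a finitely generated $A$-algebra. **Theorem.**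 Let $A\to B$ be an extension of domains that is essentially of finite type, with $A$ a Nagata ring. Then $A^{s_c,*}_B$ exists; it is in fact the greatest intermediate ring $C$ such that $A\to C$ is centrally subintegral. Moreover: 1. Let $S\subset A$ be a multiplicative subset with $1\in S$ and $0\notin S$. Then $(S^{-1}A)^{s_c,*}_{S^{-1}B}$ exists, again as the greatest intermediate ring that is centrally subintegral over $S^{-1}A$, and, as subrings of $S^{-1}B$, $$S^{-1}(A^{s_c,*}_B)=(S^{-1}A)^{s_c,*}_{S^{-1}B}.$$ 2. In particular, for every prime ideal $\mathfrak p$ of $A$, $(A^{s_c,*}_B)_{\mathfrak p}=(A_{\mathfrak p})^{s_c,*}_{B_{\mathfrak p}}$, where $B_{\mathfrak p}=(A\setminus\mathfrak p)^{-1}B$. 3. Inside $\mathcal K(B)$, $$A^{s_c,*}_B=\bigcap_{\mathfrak p\in\operatorname{Spec}A}(A_{\mathfrak p})^{s_c,*}_{B_{\mathfrak p}}.$$ -/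

import Mathlib

universe u v w x

/-- A domain `R` is Japanese if for every finite extension `L` of its fraction field the integral
closure of `R` in `L` is a finite `R`-module. A finite extension of the fraction field of `R` is
isomorphic to one that lives in the universe of `R`, so nothing is lost by taking `L` there. -/
def IsJapaneseDomain (R : Type u) [CommRing R] [IsDomain R] : Prop :=
  ∀ (L : Type u) [Field L] [Algebra (FractionRing R) L] [Algebra R L]
    [IsScalarTower R (FractionRing R) L] [Module.Finite (FractionRing R) L],
    Module.Finite R (integralClosure R L)

/-- A Nagata ring: a noetherian ring all of whose quotients by prime ideals are Japanese. -/
class IsNagataRing (R : Type u) [CommRing R] : Prop extends IsNoetherianRing R where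
  japanese : ∀ (p : Ideal R) [p.IsPrime], IsJapaneseDomain (R ⧸ p)

section Central

variable (A : Type u) [CommRing A]

/-- An ideal `I` of a domain `A` with fraction field `K` is central if `a ^ 2 + b ∈ I` implies
`a ∈ I`, for every `a` in `A` and every sum of squares `b` of elements of `K`
(the hypothesis says that `a ^ 2 + b` is an element of `K` that belongs to `I ⊆ A ⊆ K`). -/
def IsCentralIdeal {A : Type u} [CommRing A] (I : Ideal A) : Prop :=
  ∀ (a : A) (b : FractionRing A), IsSumSq b →
    (∃ c ∈ I, algebraMap A (FractionRing A) c = algebraMap A (FractionRing A) a ^ 2 + b) →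
      a ∈ I

/-- The central spectrum: the set of central prime ideals. -/
def centralSpectrum : Set (PrimeSpectrum A) :=
  {p | IsCentralIdeal p.asIdeal}

end Central

section Seminormalization

variable (A : Type u) [CommRing A] (B : Type v) [CommRing B] [Algebra A B]

/-- An extension `A → B` of domains is centrally subintegral if it is integral, and if contraction
of prime ideals is a bijection from the central spectrum of `B` onto that of `A` which is
equiresidual, that is, the residue field extensions are isomorphisms. -/
structure IsCentrallySubintegral : Prop where
  integral : Algebra.IsIntegral A B
  bijOn : Set.BijOn (PrimeSpectrum.comap (algebraMap A B)) (centralSpectrum B) (centralSpectrum A)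
  equiresidual : ∀ q ∈ centralSpectrum B,
    Function.Bijective (Ideal.ResidueField.map (q.asIdeal.comap (algebraMap A B)) q.asIdeal
      (algebraMap A B) rfl)

/-- The intermediate rings `C` between `A` and `B` such that `A → C` is centrally subintegral. -/
def centrallySubintegralSubextensions : Set (Subalgebra A B) :=
  {C | IsCentrallySubintegral A C}

open Classical in
/-- The central seminormalization of `A` in `B`: the unique maximal element among the intermediate
rings `C` between `A` and `B` such that `A → C` is centrally subintegral
(by convention the image of `A` if there is no unique maximal element). -/
noncomputable def centralSeminormalization : Subalgebra A B :=
  if h : ∃! C : Subalgebra A B, Maximal (· ∈ centrallySubintegralSubextensions A B) C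
  then h.choose else ⊥

end Seminormalization

section Localization

/-- For `S ⊆ A`, an intermediate ring `C` between `A` and `B`, and localizations `SA = S⁻¹A` and
`SB = S⁻¹B`, the localization `S⁻¹C` as a subring of `S⁻¹B`: the set of all fractions `c / s` with
`c ∈ C` and `s ∈ S`. -/
def Subalgebra.localizedAt {A : Type u} [CommRing A] {B : Type v} [CommRing B] [Algebra A B]
    (S : Submonoid A) (SA : Type w) [CommRing SA] (SB : Type x) [CommRing SB]
    [Algebra A SA] [Algebra B SB] [Algebra A SB] [Algebra SA SB]
    [IsScalarTower A SA SB] [IsScalarTower A B SB] [IsLocalization S SA]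
    (C : Subalgebra A B) : Subalgebra SA SB where
  carrier := {y | ∃ c ∈ C, ∃ s ∈ S, algebraMap A SB s * y = algebraMap B SB c}
  mul_mem' := by
    rintro y y' ⟨c, hc, s, hs, h⟩ ⟨c', hc', s', hs', h'⟩
    refine ⟨c * c', mul_mem hc hc', s * s', mul_mem hs hs', ?_⟩
    rw [map_mul, map_mul, ← h, ← h']
    ring
  add_mem' := by
    rintro y y' ⟨c, hc, s, hs, h⟩ ⟨c', hc', s', hs', h'⟩
    refine ⟨algebraMap A B s' * c + algebraMap A B s * c',
      add_mem (mul_mem (C.algebraMap_mem s') hc) (mul_mem (C.algebraMap_mem s) hc'),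
      s * s', mul_mem hs hs', ?_⟩
    rw [map_add, map_mul, map_mul, map_mul, ← h, ← h', ← IsScalarTower.algebraMap_apply A B SB,
      ← IsScalarTower.algebraMap_apply A B SB]
    ring
  algebraMap_mem' := by
    intro r
    obtain ⟨⟨a, s⟩, h⟩ := IsLocalization.surj S r
    refine ⟨algebraMap A B a, C.algebraMap_mem a, s, s.2, ?_⟩
    rw [← IsScalarTower.algebraMap_apply A B SB, IsScalarTower.algebraMap_apply A SA SB,
      IsScalarTower.algebraMap_apply A SA SB, ← map_mul, mul_comm, h]

/-- For an extension `A → B` of domains and a prime ideal `p` of `A`, the inclusion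
`b / s ↦ b / s` of the localization `B_p` into the fraction field of `B`. -/
noncomputable def localizationAtPrimeToFractionRing {A : Type u} [CommRing A] [IsDomain A]
    (B : Type v) [CommRing B] [IsDomain B] [Algebra A B] [FaithfulSMul A B]
    (p : Ideal A) [p.IsPrime] :
    Localization (Algebra.algebraMapSubmonoid B p.primeCompl) →+* FractionRing B :=
  IsLocalization.map (T := nonZeroDivisors B) (FractionRing B) (RingHom.id B)
    (algebraMapSubmonoid_le_nonZeroDivisors_of_faithfulSMul B p.primeCompl_le_nonZeroDivisors)

end Localization

/-!
Let `T` be the set of elements of `A` that are sums of squares in the fraction field, so that an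
ideal is central if `a ^ 2 + t ∈ I` with `t ∈ T` implies `a ∈ I`.

If `-1 ∈ T`, there are no central primes over `A` or over any extension of it, and "centrally
subintegral" means "integral": the seminormalization is the integral closure of `A` in `B`.

If `-1 ∉ T`, the zero ideal of `A` is central, and equiresiduality at zero makes every centrally
subintegral extension birational. The main tool is then lying over: along a birational integral
extension every central prime lifts to a central prime
(`exists_central_comap_eq`, by an estimate in the partial order that sums of squares define on the
fraction field, `mem_of_sq_add_mem_map`). Hence a birational integral extension `C` is centrally
subintegral exactly if every `c ∈ C` takes, at all central primes over a central prime `p`, one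
common value in the residue field of `p` (`isCentrallySubintegral_iff`). So the greatest centrally
subintegral ring is the ring `centralClosure A B` of the integral elements `b` of `B` in the
fraction field of `A` which have this property (`isGreatest_centralClosure`).

Localization: an element of the central closure of `S⁻¹A` in `S⁻¹B` has a numerator `d`, integral
over `A` and a fraction over `A`, that has a common value over each central prime disjoint from `S`.
This property spreads from a central prime `p` to an open subset of `V(p)` (`IsConstantOver.exists_notMem`),
because elements vanishing at all central primes over `p` satisfy `(s * e ^ n) ^ 2 + t ∈ pC` with
`s ∉ p` and `t` a sum of squares. If `A` is noetherian, looking at the minimal primes over the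
intersection of the central primes where the property fails yields `s ∈ S` in all of these, so that
`s * d` is in the closure (`exists_mul_mem_constantSubalgebra`). The intersection formula is then
the usual argument with the ideal of denominators (`image_eq_iInter_localizedAt`).
-/

/-! ### Sums of squares of the fraction field and central primes -/

/-- The elements of a ring `A` that are sums of squares in its total fraction ring. -/
noncomputable def sumSqCone (A : Type*) [CommRing A] : Subsemiring A :=
  (Subsemiring.sumSq (FractionRing A)).comap (algebraMap A (FractionRing A))

lemma mem_sumSqCone {A : Type*} [CommRing A] {x : A} :
    x ∈ sumSqCone A ↔ IsSumSq (algebraMap A (FractionRing A) x) :=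
  Subsemiring.mem_sumSq

lemma isCentralIdeal_iff {A : Type*} [CommRing A] {I : Ideal A} :
    IsCentralIdeal I ↔ ∀ a, ∀ t ∈ sumSqCone A, a ^ 2 + t ∈ I → a ∈ I := by
  constructor
  · intro h a t ht hat
    exact h a _ (mem_sumSqCone.1 ht) ⟨_, hat, by simp⟩
  · rintro h a b hb ⟨c, hc, hcb⟩
    have hb' : algebraMap A (FractionRing A) (c - a ^ 2) = b := by simp [hcb]
    refine h a (c - a ^ 2) ?_ (by simpa using hc)
    rwa [mem_sumSqCone, hb']

section Cone

variable {A : Type*} [CommRing A]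

lemma isSumSq_mem_sumSqCone {x : A} (hx : IsSumSq x) : x ∈ sumSqCone A := by
  induction hx with
  | zero => exact zero_mem _
  | sq_add a _ ih =>
    refine add_mem ?_ ih
    rw [mem_sumSqCone, map_mul]
    exact IsSumSq.mul_self _

lemma sq_mem_sumSqCone (a : A) : a ^ 2 ∈ sumSqCone A :=
  isSumSq_mem_sumSqCone (by rw [pow_two]; exact IsSumSq.mul_self a)

variable [IsDomain A]

/-- Membership in the cone is witnessed inside the ring, by clearing denominators. -/
lemma mem_sumSqCone_iff {x : A} : x ∈ sumSqCone A ↔ ∃ c ≠ 0, IsSumSq (c ^ 2 * x) := by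
  constructor
  · intro hx
    have key : ∀ y : FractionRing A, IsSumSq y → ∃ c : A, c ≠ 0 ∧ ∃ z, IsSumSq z ∧
        algebraMap A (FractionRing A) z = algebraMap A (FractionRing A) (c ^ 2) * y := by
      intro y hy
      induction hy with
      | zero => exact ⟨1, one_ne_zero, 0, .zero, by simp⟩
      | sq_add a _ ih =>
        obtain ⟨c, hc, z, hz, h⟩ := ih
        obtain ⟨n, d, hd, rfl⟩ := IsFractionRing.div_surjective (A := A) a
        have hd0 : algebraMap A (FractionRing A) d ≠ 0 := by
          simpa using nonZeroDivisors.ne_zero hd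
        refine ⟨c * d, mul_ne_zero hc (nonZeroDivisors.ne_zero hd),
          (c * n) * (c * n) + (d * d) * z, .sq_add _ ((IsSumSq.mul_self d).mul hz), ?_⟩
        simp only [map_add, map_mul, map_pow] at h ⊢
        rw [h]
        field_simp
    obtain ⟨c, hc, z, hz, h⟩ := key _ (mem_sumSqCone.1 hx)
    rw [← map_mul] at h
    exact ⟨c, hc, IsFractionRing.injective A (FractionRing A) h ▸ hz⟩
  · rintro ⟨c, hc, h⟩
    have h1 := mem_sumSqCone.1 (isSumSq_mem_sumSqCone h)
    have hc0 : algebraMap A (FractionRing A) c ≠ 0 := by simpa using hc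
    have h2 : algebraMap A (FractionRing A) x =
        (algebraMap A (FractionRing A) c)⁻¹ * (algebraMap A (FractionRing A) c)⁻¹ *
          algebraMap A (FractionRing A) (c ^ 2 * x) := by
      rw [map_mul, map_pow]
      field_simp
    rw [mem_sumSqCone, h2]
    exact (IsSumSq.mul_self _).mul h1

lemma mem_sumSqCone_of_sq_mul {c x : A} (hc : c ≠ 0) (h : c ^ 2 * x ∈ sumSqCone A) :
    x ∈ sumSqCone A := by
  obtain ⟨d, hd, h⟩ := mem_sumSqCone_iff.1 h
  exact mem_sumSqCone_iff.2 ⟨d * c, mul_ne_zero hd hc, by rwa [mul_pow, mul_assoc]⟩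

lemma neg_one_mem_sumSqCone {s t : A} (hs : s ≠ 0) (ht : t ∈ sumSqCone A) (h : s ^ 2 + t = 0) :
    -1 ∈ sumSqCone A :=
  mem_sumSqCone_of_sq_mul hs (by rwa [mul_neg_one, ← eq_neg_of_add_eq_zero_right h])

omit [IsDomain A] in
lemma IsCentralIdeal.mem_of_sq_add {I : Ideal A} (hI : IsCentralIdeal I) {a t : A}
    (ht : t ∈ sumSqCone A) (h : a ^ 2 + t ∈ I) : a ∈ I :=
  isCentralIdeal_iff.1 hI a t ht h

omit [IsDomain A] in
/-- If the fraction field is not formally real, then there is no central prime. -/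
lemma centralSpectrum_eq_empty (h : -1 ∈ sumSqCone A) : centralSpectrum A = ∅ := by
  refine Set.eq_empty_iff_forall_notMem.2 fun p hp ↦ p.2.ne_top ?_
  refine (Ideal.eq_top_iff_one _).2 (IsCentralIdeal.mem_of_sq_add hp h ?_)
  simp

/-- If the fraction field is formally real, then the zero ideal is central. -/
lemma isCentralIdeal_bot (h : -1 ∉ sumSqCone A) : IsCentralIdeal (⊥ : Ideal A) := by
  refine isCentralIdeal_iff.2 fun a t ht hat ↦ ?_
  by_contra ha
  exact h (neg_one_mem_sumSqCone ha ht hat)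

end Cone

section Extension

variable {A : Type*} [CommRing A] {C : Type*} [CommRing C] [Algebra A C]

variable (A) in
/-- An element `c` of an `A`-algebra is a fraction over `A` if it is a quotient of two elements
of `A`, with nonzero denominator. -/
def IsFractionOver (c : C) : Prop :=
  ∃ a : A, a ≠ 0 ∧ ∃ b : A, algebraMap A C a * c = algebraMap A C b

variable [IsDomain A]

lemma IsFractionOver.mul {c d : C} (hc : IsFractionOver A c) (hd : IsFractionOver A d) :
    IsFractionOver A (c * d) := by
  obtain ⟨a, ha, b, hb⟩ := hc
  obtain ⟨a', ha', b', hb'⟩ := hd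
  exact ⟨a * a', mul_ne_zero ha ha', b * b', by rw [map_mul, map_mul, ← hb, ← hb']; ring⟩

lemma IsFractionOver.add {c d : C} (hc : IsFractionOver A c) (hd : IsFractionOver A d) :
    IsFractionOver A (c + d) := by
  obtain ⟨a, ha, b, hb⟩ := hc
  obtain ⟨a', ha', b', hb'⟩ := hd
  refine ⟨a * a', mul_ne_zero ha ha', a' * b + a * b', ?_⟩
  rw [map_mul, map_add, map_mul, map_mul, ← hb, ← hb']; ring

variable [IsDomain C] [FaithfulSMul A C]

lemma algebraMap_mem_sumSqCone {a : A} (ha : a ∈ sumSqCone A) :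
    algebraMap A C a ∈ sumSqCone C := by
  obtain ⟨c, hc, h⟩ := mem_sumSqCone_iff.1 ha
  refine mem_sumSqCone_of_sq_mul (c := algebraMap A C c) (by simpa using hc) ?_
  rw [← map_pow, ← map_mul]
  refine isSumSq_mem_sumSqCone ?_
  generalize c ^ 2 * a = y at h
  induction h with
  | zero => simp
  | sq_add a _ ih => simpa using IsSumSq.sq_add _ ih

/-- A birational extension does not change the sums of squares of the fraction field. -/
lemma algebraMap_mem_sumSqCone_iff (hC : ∀ c : C, IsFractionOver A c) {a : A} :
    algebraMap A C a ∈ sumSqCone C ↔ a ∈ sumSqCone A := by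
  refine ⟨fun h ↦ ?_, algebraMap_mem_sumSqCone⟩
  obtain ⟨c, hc, h⟩ := mem_sumSqCone_iff.1 h
  have key : ∀ y : C, IsSumSq y → ∃ d : A, d ≠ 0 ∧ ∃ z, IsSumSq z ∧
      algebraMap A C z = algebraMap A C (d ^ 2) * y := by
    intro y hy
    induction hy with
    | zero => exact ⟨1, one_ne_zero, 0, .zero, by simp⟩
    | sq_add e _ ih =>
      obtain ⟨d, hd, z, hz, h⟩ := ih
      obtain ⟨a', ha', b', hb'⟩ := hC e
      refine ⟨d * a', mul_ne_zero hd ha', (d * b') * (d * b') + (a' * a') * z,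
        .sq_add _ ((IsSumSq.mul_self a').mul hz), ?_⟩
      simp only [map_add, map_mul, map_pow] at h ⊢
      rw [h, ← hb']
      ring
  obtain ⟨d, hd, z, hz, hz'⟩ := key _ h
  obtain ⟨a', ha', b', hb'⟩ := hC c
  have hb0 : b' ≠ 0 := by
    rintro rfl
    rw [map_zero] at hb'
    exact mul_ne_zero (by simpa using ha') hc hb'
  refine mem_sumSqCone_of_sq_mul (c := d * b') (mul_ne_zero hd hb0) ?_
  have : (d * b') ^ 2 * a = a' * a' * z := by
    apply FaithfulSMul.algebraMap_injective A C
    simp only [map_mul, map_pow, ← hb', hz']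
    ring
  rw [this]
  exact isSumSq_mem_sumSqCone ((IsSumSq.mul_self a').mul hz)

lemma IsCentralIdeal.comap_algebraMap {I : Ideal C} (hI : IsCentralIdeal I) :
    IsCentralIdeal (I.comap (algebraMap A C)) := by
  refine isCentralIdeal_iff.2 fun a t ht h ↦ ?_
  refine hI.mem_of_sq_add (algebraMap_mem_sumSqCone ht) ?_
  simpa using h

end Extension

/-- The existence of central primes: an ideal that contains no `m ^ 2 + t`, with `m` in a
multiplicative set `M` and `t` a sum of squares of the fraction field, lies in a central prime
disjoint from `M`. -/
lemma exists_central_prime {C : Type*} [CommRing C] (I : Ideal C) (M : Submonoid C)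
    (h : ∀ m ∈ M, ∀ t ∈ sumSqCone C, m ^ 2 + t ∉ I) :
    ∃ q ∈ centralSpectrum C, I ≤ q.asIdeal ∧ ∀ m ∈ M, m ∉ q.asIdeal := by
  let N : Submonoid C :=
    { carrier := {x | ∃ m ∈ M, ∃ t ∈ sumSqCone C, m ^ 2 + t = x}
      one_mem' := ⟨1, one_mem M, 0, zero_mem _, by simp⟩
      mul_mem' := by
        rintro _ _ ⟨m, hm, t, ht, rfl⟩ ⟨m', hm', t', ht', rfl⟩
        refine ⟨m * m', mul_mem hm hm', m ^ 2 * t' + t * m' ^ 2 + t * t', ?_, by ring⟩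
        exact add_mem (add_mem (mul_mem (sq_mem_sumSqCone m) ht')
          (mul_mem ht (sq_mem_sumSqCone m'))) (mul_mem ht ht') }
  have hdis : Disjoint (I : Set C) N := by
    refine Set.disjoint_left.2 ?_
    rintro _ hx ⟨m, hm, t, ht, rfl⟩
    exact h m hm t ht hx
  obtain ⟨q, hIq, hq⟩ := zorn_le_nonempty₀ {p : Ideal C | Disjoint (p : Set C) N}
    (fun c hc hc' x hx ↦ by
      have : Nonempty c := ⟨⟨x, hx⟩⟩
      refine ⟨sSup c, Set.disjoint_left.mpr fun y hy ↦ ?_, fun _ ↦ le_sSup⟩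
      have ⟨p, hp⟩ := (Submodule.mem_iSup_of_directed _ hc'.directed).mp (sSup_eq_iSup' c ▸ hy)
      exact Set.disjoint_left.mp (hc p.2) hp) I hdis
  have hprime : q.IsPrime :=
    Ideal.isPrime_of_maximally_disjoint _ N hq.1 (fun _ ↦ hq.not_prop_of_gt)
  refine ⟨⟨q, hprime⟩, isCentralIdeal_iff.2 fun a t ht hat ↦ ?_, hIq, fun m hm hmq ↦ ?_⟩
  · by_contra ha
    -- by maximality `q + (a)` contains some `m ^ 2 + s`; its square, corrected by a multiple
    -- of `a ^ 2 + t`, is again of this form, but lies in `q`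
    have hlt : q < q ⊔ Ideal.span {a} := Submodule.lt_sup_iff_notMem.mpr ha
    obtain ⟨x, hx, hxN⟩ := Set.not_disjoint_iff.1 (hq.not_prop_of_gt hlt)
    obtain ⟨i, hi, j, hj, rfl⟩ := Submodule.mem_sup.1 hx
    obtain ⟨r, rfl⟩ := Ideal.mem_span_singleton'.1 hj
    obtain ⟨m, hm, s, hs, hms⟩ := N.mul_mem hxN hxN
    refine Set.disjoint_left.1 hq.1 (?_ : m ^ 2 + (s + r ^ 2 * t) ∈ q)
      ⟨m, hm, _, add_mem hs (mul_mem (sq_mem_sumSqCone r) ht), rfl⟩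
    have : m ^ 2 + (s + r ^ 2 * t) = i * (i + 2 * (r * a)) + r ^ 2 * (a ^ 2 + t) := by
      rw [← add_assoc, hms]; ring
    rw [this]
    exact q.add_mem (q.mul_mem_right _ hi) (q.mul_mem_left _ hat)
  · refine Set.disjoint_left.1 hq.1 (?_ : m ^ 2 ∈ q) ⟨m, hm, 0, zero_mem _, by simp⟩
    rw [pow_two]
    exact q.mul_mem_left _ hmq

/-! ### Lying over for central primes -/

section Estimates

variable {A : Type*} [CommRing A]

lemma exists_add_pow_eq {a t : A} (ha : a ∈ sumSqCone A) (ht : t ∈ sumSqCone A) (k : ℕ) :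
    ∃ r ∈ sumSqCone A, (a + t) ^ k = a ^ k + r := by
  induction k with
  | zero => exact ⟨0, zero_mem _, by simp⟩
  | succ k ih =>
    obtain ⟨r, hr, h⟩ := ih
    exact ⟨a ^ k * t + r * a + r * t, add_mem (add_mem (mul_mem (pow_mem ha k) ht)
      (mul_mem hr ha)) (mul_mem hr ht), by rw [pow_succ, h]; ring⟩

/-- The Cauchy–Schwarz inequality `(∑ uᵢ)² ≤ n ∑ uᵢ²` for the partial order of the cone. -/
lemma exists_sum_sq_add_eq {ι : Type*} (s : Finset ι) (u : ι → A) :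
    ∃ r ∈ sumSqCone A, (∑ i ∈ s, u i) ^ 2 + r = s.card * ∑ i ∈ s, u i ^ 2 := by
  classical
  induction s using Finset.induction_on with
  | empty => exact ⟨0, zero_mem _, by simp⟩
  | insert j s hj ih =>
    obtain ⟨r, hr, h⟩ := ih
    refine ⟨r + ∑ i ∈ s, (u j - u i) ^ 2,
      add_mem hr (sum_mem fun i _ ↦ sq_mem_sumSqCone _), ?_⟩
    have h2 : ∑ i ∈ s, (u j - u i) ^ 2 =
        s.card * u j ^ 2 - 2 * u j * ∑ i ∈ s, u i + ∑ i ∈ s, u i ^ 2 := by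
      simp only [sub_sq, Finset.sum_add_distrib, Finset.sum_sub_distrib, Finset.sum_const,
        nsmul_eq_mul, Finset.mul_sum]
    rw [Finset.sum_insert hj, Finset.sum_insert hj, Finset.card_insert_of_notMem hj, h2]
    push_cast
    linear_combination h

end Estimates

section LyingOver

variable {A : Type*} [CommRing A] [IsDomain A] {C : Type*} [CommRing C] [IsDomain C]
  [Algebra A C] [FaithfulSMul A C]

/-- The key estimate for lying over. Suppose `x = s ^ 2 + t` lies in `pC`, and write
`x ^ n = - ∑ aᵢ x ^ i` with `aᵢ ∈ p`. For the partial order defined by the sums of squares,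
`s ^ 2 ≤ x`, so Cauchy–Schwarz gives `s ^ (4 * n) ≤ n ∑ aᵢ ^ 2 s ^ (4 * i)`. The right-hand side is
in `p`, and the difference is a sum of squares of the fraction field of `A`. -/
lemma mem_of_sq_add_mem_map [Algebra.IsIntegral A C] (hC : ∀ c : C, IsFractionOver A c)
    {p : Ideal A} [p.IsPrime] (hp : IsCentralIdeal p) {s : A} {t : C} (ht : t ∈ sumSqCone C)
    (h : algebraMap A C s ^ 2 + t ∈ p.map (algebraMap A C)) : s ∈ p := by
  set σ := algebraMap A C s with hσ
  set x := σ ^ 2 + t with hx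
  by_cases hs0 : s = 0
  · simp [hs0]
  by_cases hx0 : x = 0
  · have h1 : (-1 : C) ∈ sumSqCone C :=
      neg_one_mem_sumSqCone (by simpa [hσ] using hs0) ht hx0
    rw [show (-1 : C) = algebraMap A C (-1) by simp, algebraMap_mem_sumSqCone_iff hC] at h1
    refine absurd (hp.mem_of_sq_add (a := 1) h1 (by simp)) ?_
    exact fun h ↦ Ideal.IsPrime.ne_top ‹_› ((Ideal.eq_top_iff_one p).2 h)
  obtain ⟨f, hf, hfx, hfp⟩ := Polynomial.exists_monic_aeval_eq_zero_forall_mem_of_mem_map h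
  set n := f.natDegree
  set a := f.coeff
  have hsum : x ^ n = - ∑ i ∈ Finset.range n, algebraMap A C (a i) * x ^ i := by
    rw [Polynomial.aeval_eq_sum_range, Finset.sum_range_succ, hf.coeff_natDegree, one_smul] at hfx
    simp only [Algebra.smul_def] at hfx
    exact eq_neg_of_add_eq_zero_right hfx
  obtain ⟨r, hr, hcs⟩ := exists_sum_sq_add_eq (Finset.range n)
    fun i ↦ algebraMap A C (a i) * σ ^ (2 * n) * x ^ i
  have hle : ∀ i ∈ Finset.range n, ∃ r ∈ sumSqCone C,
      (algebraMap A C (a i) * σ ^ (2 * n) * x ^ i) ^ 2 + r =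
        algebraMap A C (a i ^ 2 * s ^ (4 * i)) * x ^ (2 * n) := by
    intro i hi
    obtain ⟨m, hm⟩ := Nat.exists_eq_add_of_lt (Finset.mem_range.1 hi)
    obtain ⟨r, hr, h⟩ := exists_add_pow_eq (sq_mem_sumSqCone σ) ht (2 * (m + 1))
    refine ⟨(algebraMap A C (a i) * σ ^ (2 * i) * x ^ i) ^ 2 * r,
      mul_mem (sq_mem_sumSqCone _) hr, ?_⟩
    rw [← hx] at h
    have h' : x ^ (2 * n) = x ^ (2 * i) * x ^ (2 * (m + 1)) := by
      rw [hm]; ring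
    rw [h', h, map_mul, map_pow, map_pow, ← hσ, hm]
    ring
  choose! ρ hρ hle using hle
  set d : A := n * ∑ i ∈ Finset.range n, a i ^ 2 * s ^ (4 * i) with hd
  have hdp : d ∈ p := by
    refine p.mul_mem_left _ (sum_mem fun i hi ↦ p.mul_mem_right _ ?_)
    rw [pow_two]
    exact p.mul_mem_left _ (hfp i (Finset.mem_range.1 hi).ne)
  have hdiff : d - s ^ (4 * n) ∈ sumSqCone A := by
    rw [← algebraMap_mem_sumSqCone_iff hC]
    refine mem_sumSqCone_of_sq_mul (c := x ^ n) (pow_ne_zero _ hx0) ?_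
    have : (x ^ n) ^ 2 * algebraMap A C (d - s ^ (4 * n)) =
        r + n * ∑ i ∈ Finset.range n, ρ i := by
      have h1 : ∑ i ∈ Finset.range n, algebraMap A C (a i) * σ ^ (2 * n) * x ^ i =
          - (σ ^ (2 * n) * x ^ n) := by
        rw [hsum, mul_neg, neg_neg, Finset.mul_sum]
        exact Finset.sum_congr rfl fun i _ ↦ by ring
      have h2 : (∑ i ∈ Finset.range n, (algebraMap A C (a i) * σ ^ (2 * n) * x ^ i) ^ 2) +
          ∑ i ∈ Finset.range n, ρ i =
          algebraMap A C (∑ i ∈ Finset.range n, a i ^ 2 * s ^ (4 * i)) * x ^ (2 * n) := by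
        rw [← Finset.sum_add_distrib, map_sum, Finset.sum_mul]
        exact Finset.sum_congr rfl hle
      rw [h1, Finset.card_range] at hcs
      rw [map_sub, hd, map_mul, map_natCast, map_pow, ← hσ]
      linear_combination (n : C) * (-h2) - hcs
    rw [this]
    exact add_mem hr (mul_mem (natCast_mem _ n) (sum_mem hρ))
  refine Ideal.IsPrime.mem_of_pow_mem ‹_› (2 * n) (hp.mem_of_sq_add hdiff ?_)
  convert hdp using 1
  ring

/-- Lying over: along a birational integral extension, every central prime is the contraction of
a central prime. -/
lemma exists_central_comap_eq [Algebra.IsIntegral A C] (hC : ∀ c : C, IsFractionOver A c)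
    {p : PrimeSpectrum A} (hp : p ∈ centralSpectrum A) :
    ∃ q ∈ centralSpectrum C, q.comap (algebraMap A C) = p := by
  obtain ⟨q, hq, hpq, hqM⟩ := exists_central_prime (p.asIdeal.map (algebraMap A C))
    (p.asIdeal.primeCompl.map (algebraMap A C)) (by
      rintro _ ⟨s, hs, rfl⟩ t ht h
      exact hs (mem_of_sq_add_mem_map hC hp ht h))
  refine ⟨q, hq, PrimeSpectrum.ext (le_antisymm (fun a ha ↦ ?_) (Ideal.map_le_iff_le_comap.1 hpq))⟩
  by_contra hap
  exact hqM _ ⟨a, hap, rfl⟩ ha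

omit [IsDomain A] [IsDomain C] [FaithfulSMul A C] in
/-- An element `e` that vanishes at all central primes over `p` vanishes, generically on `V(p)`,
at the central primes over the points of `V(p)`: this follows from
`(s * e ^ n) ^ 2 + t ∈ pC`, for some `s ∉ p` and some sum of squares `t`. -/
lemma exists_notMem_forall_mem (p : PrimeSpectrum A) {e : C}
    (he : ∀ q ∈ centralSpectrum C, q.comap (algebraMap A C) = p → e ∈ q.asIdeal) :
    ∃ s ∉ p.asIdeal, ∀ q ∈ centralSpectrum C, p.asIdeal ≤ q.asIdeal.comap (algebraMap A C) →
      algebraMap A C s ∉ q.asIdeal → e ∈ q.asIdeal := by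
  by_contra! hcon
  obtain ⟨q, hq, hpq, hqM⟩ := exists_central_prime (p.asIdeal.map (algebraMap A C))
    (p.asIdeal.primeCompl.map (algebraMap A C) ⊔ Submonoid.powers e) (by
      intro m hm t ht h
      obtain ⟨_, ⟨s, hs, rfl⟩, _, ⟨n, rfl⟩, rfl⟩ := Submonoid.mem_sup.1 hm
      obtain ⟨q, hq, hpq, hsq, heq⟩ := hcon s hs
      have h1 := IsCentralIdeal.mem_of_sq_add hq ht (Ideal.map_le_iff_le_comap.2 hpq h)
      obtain h1 | h1 := q.2.mem_or_mem h1
      · exact hsq h1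
      · exact heq (q.2.mem_of_pow_mem n h1))
  refine hqM e (Submonoid.mem_sup_right (Submonoid.mem_powers e)) (he q hq ?_)
  refine PrimeSpectrum.ext (le_antisymm (fun a ha ↦ ?_) (Ideal.map_le_iff_le_comap.1 hpq))
  by_contra hap
  exact hqM _ (Submonoid.mem_sup_left ⟨a, hap, rfl⟩) ha

end LyingOver

/-! ### Functions that are constant on the central fibers -/

section Constant

variable {A : Type*} [CommRing A] {C : Type*} [CommRing C] [Algebra A C]

/-- The element `c` takes one and the same value `a / b`, with `a / b` in the residue field of `p`,
at all central primes of `C` over `p`. -/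
def IsConstantOver (p : PrimeSpectrum A) (c : C) : Prop :=
  ∃ a b : A, b ∉ p.asIdeal ∧ ∀ q ∈ centralSpectrum C, q.comap (algebraMap A C) = p →
    algebraMap A C b * c - algebraMap A C a ∈ q.asIdeal

variable (A C) in
/-- The elements of `C` that are constant on every fiber of the contraction
from the central spectrum of `C` to that of `A`. -/
def constantSubalgebra : Subalgebra A C where
  carrier := {c | ∀ p ∈ centralSpectrum A, IsConstantOver p c}
  mul_mem' := by
    intro c c' hc hc' p hp
    obtain ⟨a, b, hb, h⟩ := hc p hp
    obtain ⟨a', b', hb', h'⟩ := hc' p hp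
    refine ⟨a * a', b * b', fun hbb ↦ (p.2.mem_or_mem hbb).elim hb hb', fun q hq hqp ↦ ?_⟩
    have : algebraMap A C (b * b') * (c * c') - algebraMap A C (a * a') =
        algebraMap A C b * c * (algebraMap A C b' * c' - algebraMap A C a') +
          algebraMap A C a' * (algebraMap A C b * c - algebraMap A C a) := by
      simp only [map_mul]; ring
    rw [this]
    exact add_mem (Ideal.mul_mem_left _ _ (h' q hq hqp)) (Ideal.mul_mem_left _ _ (h q hq hqp))
  add_mem' := by
    intro c c' hc hc' p hp
    obtain ⟨a, b, hb, h⟩ := hc p hp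
    obtain ⟨a', b', hb', h'⟩ := hc' p hp
    refine ⟨a * b' + a' * b, b * b', fun hbb ↦ (p.2.mem_or_mem hbb).elim hb hb',
      fun q hq hqp ↦ ?_⟩
    have : algebraMap A C (b * b') * (c + c') - algebraMap A C (a * b' + a' * b) =
        algebraMap A C b * (algebraMap A C b' * c' - algebraMap A C a') +
          algebraMap A C b' * (algebraMap A C b * c - algebraMap A C a) := by
      simp only [map_mul, map_add]; ring
    rw [this]
    exact add_mem (Ideal.mul_mem_left _ _ (h' q hq hqp)) (Ideal.mul_mem_left _ _ (h q hq hqp))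
  algebraMap_mem' := fun a p _ ↦
    ⟨a, 1, fun h ↦ p.2.ne_top ((Ideal.eq_top_iff_one _).2 h), fun q _ _ ↦ by simp⟩

lemma mem_constantSubalgebra {c : C} :
    c ∈ constantSubalgebra A C ↔ ∀ p ∈ centralSpectrum A, IsConstantOver p c :=
  Iff.rfl

/-- Being constant at a central prime `p` is an open condition on `V(p)`. -/
lemma IsConstantOver.exists_notMem {p : PrimeSpectrum A} {c : C} (h : IsConstantOver p c) :
    ∃ s ∉ p.asIdeal, ∀ p' : PrimeSpectrum A, p.asIdeal ≤ p'.asIdeal → s ∉ p'.asIdeal →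
      IsConstantOver p' c := by
  obtain ⟨a, b, hb, h⟩ := h
  obtain ⟨s, hs, hsq⟩ := exists_notMem_forall_mem p h
  refine ⟨s * b, fun hsb ↦ (p.2.mem_or_mem hsb).elim hs hb, fun p' hpp' hsp' ↦
    ⟨a, b, fun hb' ↦ hsp' (Ideal.mul_mem_left _ _ hb'), ?_⟩⟩
  rintro q hq rfl
  exact hsq q hq hpp' fun hs' ↦ hsp' (Ideal.mul_mem_right b _ hs')

variable [IsDomain C] {D : Type*} [CommRing D] [IsDomain D] [Algebra A D]

/-- Constancy over `p` is preserved by enlarging the ring. -/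
lemma IsConstantOver.map {p : PrimeSpectrum A} {c : C} (h : IsConstantOver p c)
    (f : C →ₐ[A] D) (hf : Function.Injective f) : IsConstantOver p (f c) := by
  obtain ⟨a, b, hb, h⟩ := h
  refine ⟨a, b, hb, fun q hq hqp ↦ ?_⟩
  algebraize [f.toRingHom]
  have : FaithfulSMul C D := (faithfulSMul_iff_algebraMap_injective C D).2 hf
  have h1 := h (q.comap (algebraMap C D)) (IsCentralIdeal.comap_algebraMap (A := C) hq) (by
    rw [← hqp, ← PrimeSpectrum.comap_comp_apply]
    congr 1
    exact f.comp_algebraMap)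
  have h2 : f (algebraMap A C b * c - algebraMap A C a) ∈ q.asIdeal := h1
  simpa using h2

/-- Constancy over `p` descends along birational integral extensions, by lying over. -/
lemma IsConstantOver.of_map {p : PrimeSpectrum A} {c : C}
    (f : C →ₐ[A] D) (hf : Function.Injective f) (hfi : f.toRingHom.IsIntegral)
    (hfr : ∀ d : D, ∃ c₁ ≠ 0, ∃ c₂, f c₁ * d = f c₂)
    (h : IsConstantOver p (f c)) : IsConstantOver p c := by
  obtain ⟨a, b, hb, h⟩ := h
  refine ⟨a, b, hb, fun q hq hqp ↦ ?_⟩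
  algebraize [f.toRingHom]
  have : FaithfulSMul C D := (faithfulSMul_iff_algebraMap_injective C D).2 hf
  obtain ⟨q', hq', rfl⟩ := exists_central_comap_eq (A := C) (C := D) hfr hq
  have h1 := h q' hq' (by
    rw [← hqp, ← PrimeSpectrum.comap_comp_apply]
    congr 1
    exact f.comp_algebraMap.symm)
  have h2 : f (algebraMap A C b * c - algebraMap A C a) ∈ q'.asIdeal := by simpa using h1
  exact h2

end Constant

/-! ### Existence of the central seminormalization -/

lemma Ideal.ResidueField.exists_mul_eq {R : Type*} [CommRing R] (p : Ideal R) [p.IsPrime]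
    (y : p.ResidueField) : ∃ a b : R, b ∉ p ∧
      algebraMap R p.ResidueField b * y = algebraMap R p.ResidueField a := by
  obtain ⟨a, b, hb, rfl⟩ := IsFractionRing.div_surjective (A := R ⧸ p) y
  obtain ⟨a, rfl⟩ := Ideal.Quotient.mk_surjective a
  obtain ⟨b, rfl⟩ := Ideal.Quotient.mk_surjective b
  have hbp : b ∉ p := fun h ↦ nonZeroDivisors.ne_zero hb (Ideal.Quotient.eq_zero_iff_mem.2 h)
  refine ⟨a, b, hbp, ?_⟩
  rw [Ideal.algebraMap_quotient_residueField_mk, Ideal.algebraMap_quotient_residueField_mk]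
  refine mul_div_cancel₀ _ ?_
  rwa [Ne, Ideal.algebraMap_residueField_eq_zero]

section Subintegral

variable {A : Type*} [CommRing A] {C : Type*} [CommRing C] [Algebra A C]

lemma exists_sub_mem_of_residueFieldMap_surjective (q : Ideal C) [q.IsPrime]
    (h : Function.Surjective (Ideal.ResidueField.map (q.comap (algebraMap A C)) q
      (algebraMap A C) rfl)) (c : C) :
    ∃ a b : A, algebraMap A C b ∉ q ∧ algebraMap A C b * c - algebraMap A C a ∈ q := by
  obtain ⟨y, hy⟩ := h (algebraMap C q.ResidueField c)
  obtain ⟨a, b, hb, hab⟩ := Ideal.ResidueField.exists_mul_eq _ y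
  refine ⟨a, b, hb, ?_⟩
  have := congrArg (Ideal.ResidueField.map (q.comap (algebraMap A C)) q (algebraMap A C) rfl) hab
  rw [map_mul, hy, Ideal.ResidueField.map_algebraMap, Ideal.ResidueField.map_algebraMap,
    ← map_mul] at this
  rw [← Ideal.algebraMap_residueField_eq_zero, map_sub, this, sub_self]

lemma residueFieldMap_bijective (q : Ideal C) [q.IsPrime]
    (h : ∀ c : C, ∃ a b : A, algebraMap A C b ∉ q ∧
      algebraMap A C b * c - algebraMap A C a ∈ q) :
    Function.Bijective (Ideal.ResidueField.map (q.comap (algebraMap A C)) q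
      (algebraMap A C) rfl) := by
  set f := Ideal.ResidueField.map (q.comap (algebraMap A C)) q (algebraMap A C) rfl with hf
  have key : ∀ c : C, ∃ y, f y = algebraMap C q.ResidueField c := by
    intro c
    obtain ⟨a, b, hb, hab⟩ := h c
    refine ⟨algebraMap A _ a / algebraMap A _ b, ?_⟩
    rw [map_div₀, hf, Ideal.ResidueField.map_algebraMap, Ideal.ResidueField.map_algebraMap]
    rw [← Ideal.algebraMap_residueField_eq_zero] at hb
    rw [← Ideal.algebraMap_residueField_eq_zero, map_sub, map_mul, sub_eq_zero] at hab
    rw [← hab, mul_div_cancel_left₀ _ hb]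
  refine ⟨f.injective, fun z ↦ ?_⟩
  obtain ⟨c, c', hc', hz⟩ := Ideal.ResidueField.exists_mul_eq q z
  obtain ⟨y, hy⟩ := key c
  obtain ⟨y', hy'⟩ := key c'
  refine ⟨y / y', ?_⟩
  rw [← Ideal.algebraMap_residueField_eq_zero] at hc'
  rw [map_div₀, hy, hy', ← hz, mul_div_cancel_left₀ _ hc']

variable [IsDomain A] [IsDomain C] [FaithfulSMul A C]

/-- If the fraction field of `A` is not formally real, then all central spectra are empty. -/
lemma isCentrallySubintegral_iff_isIntegral (hA : -1 ∈ sumSqCone A) :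
    IsCentrallySubintegral A C ↔ Algebra.IsIntegral A C := by
  have hC : (-1 : C) ∈ sumSqCone C := by simpa using algebraMap_mem_sumSqCone (C := C) hA
  refine ⟨fun h ↦ h.integral, fun h ↦ ⟨h, ?_, ?_⟩⟩
  · rw [centralSpectrum_eq_empty hA, centralSpectrum_eq_empty hC]
    exact Set.bijOn_empty _
  · simp [centralSpectrum_eq_empty hC]

/-- If the fraction field of `A` is formally real, then the zero ideal is central, so that a
centrally subintegral extension is birational. -/
lemma isCentrallySubintegral_iff (hA : -1 ∉ sumSqCone A) :
    IsCentrallySubintegral A C ↔ Algebra.IsIntegral A C ∧ (∀ c : C, IsFractionOver A c) ∧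
      constantSubalgebra A C = ⊤ := by
  constructor
  · intro h
    have := h.integral
    refine ⟨h.integral, fun c ↦ ?_, ?_⟩
    · obtain ⟨q, hq, hq0⟩ := h.bijOn.surjOn (a := (⊥ : PrimeSpectrum A)) (isCentralIdeal_bot hA)
      have hq0 : q.asIdeal.comap (algebraMap A C) = ⊥ := congrArg PrimeSpectrum.asIdeal hq0
      have hqbot : q.asIdeal = ⊥ := Ideal.eq_bot_of_comap_eq_bot hq0
      obtain ⟨a, b, hb, hab⟩ :=
        exists_sub_mem_of_residueFieldMap_surjective q.asIdeal (h.equiresidual q hq).2 c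
      rw [hqbot, Ideal.mem_bot] at hb hab
      exact ⟨b, by rintro rfl; simp at hb, a, sub_eq_zero.1 hab⟩
    · refine eq_top_iff.2 fun c _ p hp ↦ ?_
      obtain ⟨q, hq, rfl⟩ := h.bijOn.surjOn hp
      obtain ⟨a, b, hb, hab⟩ :=
        exists_sub_mem_of_residueFieldMap_surjective q.asIdeal (h.equiresidual q hq).2 c
      refine ⟨a, b, hb, fun q' hq' hqq' ↦ ?_⟩
      rwa [h.bijOn.injOn hq' hq hqq']
  · rintro ⟨hint, hfrac, htop⟩
    have hconst : ∀ c : C, ∀ p ∈ centralSpectrum A, IsConstantOver p c :=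
      fun c ↦ mem_constantSubalgebra.1 (htop ▸ Algebra.mem_top)
    have hmaps : Set.MapsTo (PrimeSpectrum.comap (algebraMap A C)) (centralSpectrum C)
        (centralSpectrum A) := fun q hq ↦ IsCentralIdeal.comap_algebraMap hq
    refine ⟨hint, ⟨hmaps, ?_, fun p hp ↦ exists_central_comap_eq hfrac hp⟩, fun q hq ↦ ?_⟩
    · have hle : ∀ q ∈ centralSpectrum C, ∀ q' ∈ centralSpectrum C,
          q.comap (algebraMap A C) = q'.comap (algebraMap A C) → q.asIdeal ≤ q'.asIdeal := by
        intro q hq q' hq' hqq' c hc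
        obtain ⟨a, b, hb, h⟩ := hconst c _ (hmaps hq')
        have haq : a ∈ (q.comap (algebraMap A C)).asIdeal := by
          have := sub_mem (Ideal.mul_mem_left q.asIdeal (algebraMap A C b) hc) (h q hq hqq')
          rwa [sub_sub_cancel] at this
        rw [hqq'] at haq
        have hbc := add_mem (h q' hq' rfl) (show algebraMap A C a ∈ q'.asIdeal from haq)
        rw [sub_add_cancel] at hbc
        exact (q'.2.mem_or_mem hbc).resolve_left hb
      exact fun q hq q' hq' h ↦
        PrimeSpectrum.ext (le_antisymm (hle q hq q' hq' h) (hle q' hq' q hq h.symm))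
    · refine residueFieldMap_bijective q.asIdeal fun c ↦ ?_
      obtain ⟨a, b, hb, h⟩ := hconst c _ (hmaps hq)
      exact ⟨a, b, hb, h q hq rfl⟩

end Subintegral

section Greatest

variable (A : Type*) [CommRing A] [IsDomain A] (B : Type*) [CommRing B]
  [Algebra A B]

/-- The elements of `B` that are integral over `A` and are fractions over `A`: the largest
intermediate ring that is integral and birational over `A`. -/
def birationalIntegralClosure : Subalgebra A B where
  carrier := {b | IsIntegral A b ∧ IsFractionOver A b}
  mul_mem' h h' := ⟨h.1.mul h'.1, h.2.mul h'.2⟩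
  add_mem' h h' := ⟨h.1.add h'.1, h.2.add h'.2⟩
  algebraMap_mem' a := ⟨isIntegral_algebraMap, 1, one_ne_zero, a, by simp⟩

variable {A B}

lemma isIntegral_of_le_birationalIntegralClosure {C : Subalgebra A B}
    (h : C ≤ birationalIntegralClosure A B) : Algebra.IsIntegral A C :=
  ⟨fun c ↦ (isIntegral_algHom_iff C.val Subtype.val_injective).1 (h c.2).1⟩

lemma isFractionOver_of_le_birationalIntegralClosure {C : Subalgebra A B}
    (h : C ≤ birationalIntegralClosure A B) (c : C) : IsFractionOver A c := by
  obtain ⟨a, ha, b, hab⟩ := (h c.2).2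
  exact ⟨a, ha, b, Subtype.ext hab⟩

variable (A B) in
/-- The elements of the birational integral closure that are constant on the central fibers. -/
def centralClosure : Subalgebra A B :=
  (constantSubalgebra A (birationalIntegralClosure A B)).map (birationalIntegralClosure A B).val

lemma centralClosure_le : centralClosure A B ≤ birationalIntegralClosure A B := by
  rintro _ ⟨d, -, rfl⟩
  exact d.2

lemma mem_centralClosure {b : B} : b ∈ centralClosure A B ↔
    ∃ h : b ∈ birationalIntegralClosure A B, ∀ p ∈ centralSpectrum A,
      IsConstantOver p (⟨b, h⟩ : birationalIntegralClosure A B) := by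
  constructor
  · rintro ⟨d, hd, rfl⟩
    exact ⟨d.2, hd⟩
  · rintro ⟨h, hb⟩
    exact ⟨⟨b, h⟩, hb, rfl⟩

omit [IsDomain A] in
lemma centralSeminormalization_eq {G : Subalgebra A B}
    (h : IsGreatest (centrallySubintegralSubextensions A B) G) :
    centralSeminormalization A B = G := by
  have hmax : ∀ C, Maximal (· ∈ centrallySubintegralSubextensions A B) C ↔ C = G := fun C ↦
    ⟨fun hC ↦ le_antisymm (h.2 hC.1) (hC.2 h.1 (h.2 hC.1)),
      fun hC ↦ hC ▸ ⟨h.1, fun _ hD _ ↦ h.2 hD⟩⟩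
  have hex : ∃! C, Maximal (· ∈ centrallySubintegralSubextensions A B) C :=
    ⟨G, (hmax G).2 rfl, fun C ↦ (hmax C).1⟩
  rw [centralSeminormalization, dif_pos hex]
  exact (hmax _).1 hex.choose_spec.1

variable [IsDomain B] [FaithfulSMul A B]

lemma isGreatest_integralClosure (hA : -1 ∈ sumSqCone A) :
    IsGreatest (centrallySubintegralSubextensions A B) (integralClosure A B) := by
  constructor
  · exact (isCentrallySubintegral_iff_isIntegral hA).2 inferInstance
  · intro C hC
    exact le_integralClosure_iff_isIntegral.2 ((isCentrallySubintegral_iff_isIntegral hA).1 hC)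

lemma isGreatest_centralClosure (hA : -1 ∉ sumSqCone A) :
    IsGreatest (centrallySubintegralSubextensions A B) (centralClosure A B) := by
  constructor
  · refine (isCentrallySubintegral_iff hA).2
      ⟨isIntegral_of_le_birationalIntegralClosure centralClosure_le,
        isFractionOver_of_le_birationalIntegralClosure centralClosure_le,
        eq_top_iff.2 fun c _ p hp ↦ ?_⟩
    obtain ⟨_, hc⟩ := mem_centralClosure.1 c.2
    refine IsConstantOver.of_map (Subalgebra.inclusion centralClosure_le)
      (Subalgebra.inclusion_injective _) ?_ (fun d ↦ ?_) (hc p hp)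
    · exact RingHom.IsIntegral.tower_top (algebraMap A _) _
        (isIntegral_of_le_birationalIntegralClosure (A := A) (B := B) le_rfl).isIntegral
    · obtain ⟨a, ha, b, h⟩ :=
        isFractionOver_of_le_birationalIntegralClosure (A := A) (B := B) le_rfl d
      exact ⟨algebraMap A _ a, by simpa using ha, algebraMap A _ b, h⟩
  · intro C hC
    obtain ⟨hint, hfrac, htop⟩ := (isCentrallySubintegral_iff hA).1 hC
    have hle : C ≤ birationalIntegralClosure A B := by
      intro c hc
      obtain ⟨a, ha, b, h⟩ := hfrac ⟨c, hc⟩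
      exact ⟨(hint.isIntegral ⟨c, hc⟩).map C.val, a, ha, b, congrArg Subtype.val h⟩
    intro c hc
    refine mem_centralClosure.2 ⟨hle hc, fun p hp ↦ ?_⟩
    have h : IsConstantOver p (⟨c, hc⟩ : C) :=
      mem_constantSubalgebra.1 (htop ▸ Algebra.mem_top) p hp
    exact h.map (Subalgebra.inclusion hle) (Subalgebra.inclusion_injective _)

lemma centralSeminormalization_eq_centralClosure (hA : -1 ∉ sumSqCone A) :
    centralSeminormalization A B = centralClosure A B :=
  centralSeminormalization_eq (isGreatest_centralClosure hA)

lemma centralSeminormalization_eq_integralClosure (hA : -1 ∈ sumSqCone A) :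
    centralSeminormalization A B = integralClosure A B :=
  centralSeminormalization_eq (isGreatest_integralClosure hA)

variable (A B) in
lemma isGreatest_centralSeminormalization :
    IsGreatest (centrallySubintegralSubextensions A B) (centralSeminormalization A B) := by
  by_cases hA : -1 ∈ sumSqCone A
  · rw [centralSeminormalization_eq_integralClosure hA]
    exact isGreatest_integralClosure hA
  · rw [centralSeminormalization_eq_centralClosure hA]
    exact isGreatest_centralClosure hA

end Greatest

/-! ### Localization -/

/-- In a noetherian ring, a minimal prime `P` over a radical ideal `J` satisfies `cP ⊆ J`
for some `c ∉ P`. -/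
lemma exists_notMem_forall_mul_mem_of_mem_minimalPrimes {A : Type*} [CommRing A]
    [IsNoetherianRing A] {J P : Ideal A} (hJ : J.IsRadical) (hP : P ∈ J.minimalPrimes) :
    ∃ c ∉ P, ∀ x ∈ P, c * x ∈ J := by
  classical
  have hfin := J.finite_minimalPrimes_of_isNoetherianRing
  have hPp : P.IsPrime := hP.1.1
  have hne : ∀ Q : Ideal A, Q ∈ hfin.toFinset.erase P → ∃ c ∈ Q, c ∉ P := by
    intro Q hQ
    rw [Finset.mem_erase, Set.Finite.mem_toFinset] at hQ
    exact SetLike.not_le_iff_exists.1 fun hle ↦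
      hQ.1 (le_antisymm hle (hP.2 hQ.2.1 hle))
  choose! c hcQ hcP using hne
  refine ⟨∏ Q ∈ hfin.toFinset.erase P, c Q, fun h ↦ ?_, fun x hx ↦ ?_⟩
  · obtain ⟨Q, hQ, hcQP⟩ := hPp.prod_mem_iff.1 h
    exact hcP Q hQ hcQP
  · refine hJ (?_ : _ ∈ J.radical)
    rw [← Ideal.sInf_minimalPrimes, Ideal.mem_sInf]
    intro Q hQ
    by_cases hQP : Q = P
    · rw [hQP]
      exact P.mul_mem_left _ hx
    · have hQ' : Q ∈ hfin.toFinset.erase P := by simpa [hQP] using hQ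
      exact Q.mul_mem_right _ (Ideal.mem_of_dvd _ (Finset.dvd_prod_of_mem c hQ') (hcQ Q hQ'))

/-- Over a noetherian ring, an element that is constant over all central primes disjoint from `S`
has a multiple by an element of `S` that is constant over all central primes.

Let `J` be the intersection of the central primes `p` over which `d` is not constant. An element
of `J ∩ S` does it. If `J ∩ S` is empty, a minimal prime `P` of `J` is disjoint from `S`.
It is central, hence `d` is constant over `P` and over a dense open part of `V(P)`, which
contradicts the choice of `P`. -/
lemma exists_mul_mem_constantSubalgebra {A : Type*} [CommRing A] [IsNoetherianRing A]
    {D : Type*} [CommRing D] [Algebra A D] (S : Submonoid A) (d : D)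
    (h : ∀ p ∈ centralSpectrum A, (∀ s ∈ S, s ∉ p.asIdeal) → IsConstantOver p d) :
    ∃ s ∈ S, algebraMap A D s * d ∈ constantSubalgebra A D := by
  set J : Ideal A := sInf {I | ∃ p ∈ centralSpectrum A, ¬ IsConstantOver p d ∧ p.asIdeal = I}
    with hJdef
  have hJ : ∀ {a}, a ∈ J ↔ ∀ p ∈ centralSpectrum A, ¬ IsConstantOver p d → a ∈ p.asIdeal := by
    intro a
    rw [hJdef, Ideal.mem_sInf]
    exact ⟨fun h p hp hpd ↦ h ⟨p, hp, hpd, rfl⟩, by rintro h _ ⟨p, hp, hpd, rfl⟩; exact h p hp hpd⟩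
  by_cases hS : ∃ s ∈ S, s ∈ J
  · obtain ⟨s, hs, hsJ⟩ := hS
    refine ⟨s, hs, fun p hp ↦ ?_⟩
    by_cases hpd : IsConstantOver p d
    · obtain ⟨a, b, hb, hq⟩ := hpd
      refine ⟨s * a, b, hb, fun q hqc hqp ↦ ?_⟩
      have := Ideal.mul_mem_left q.asIdeal (algebraMap A D s) (hq q hqc hqp)
      convert this using 1
      rw [map_mul]; ring
    · refine ⟨0, 1, fun h1 ↦ p.2.ne_top ((Ideal.eq_top_iff_one _).2 h1), ?_⟩
      rintro q hqc rfl
      have : algebraMap A D s ∈ q.asIdeal := hJ.1 hsJ _ hp hpd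
      simpa using Ideal.mul_mem_right d _ this
  · exfalso
    push Not at hS
    have hrad : J.IsRadical := fun a ⟨n, ha⟩ ↦
      hJ.2 fun p hp hpd ↦ p.2.mem_of_pow_mem n (hJ.1 ha p hp hpd)
    obtain ⟨P₀, hP₀, hJP₀, hdis⟩ := Ideal.exists_le_prime_disjoint J S
      (Set.disjoint_right.2 fun s hs ↦ hS s hs)
    obtain ⟨P, hP, hPP₀⟩ := Ideal.exists_minimalPrimes_le hJP₀
    obtain ⟨c, hcP, hc⟩ := exists_notMem_forall_mul_mem_of_mem_minimalPrimes hrad hP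
    have hPp : P.IsPrime := hP.1.1
    have hcentral : (⟨P, hPp⟩ : PrimeSpectrum A) ∈ centralSpectrum A := by
      refine isCentralIdeal_iff.2 fun a t ht hat ↦ ?_
      have hca : c * a ∈ J := hJ.2 fun p hp hpd ↦ by
        refine IsCentralIdeal.mem_of_sq_add hp (mul_mem (sq_mem_sumSqCone c) ht) ?_
        have := p.asIdeal.mul_mem_left c (hJ.1 (hc _ hat) p hp hpd)
        convert this using 1
        ring
      exact (hPp.mem_or_mem (hP.1.2 hca)).resolve_left hcP
    obtain ⟨f, hfP, hf⟩ := (h _ hcentral fun s hs hsP ↦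
      Set.disjoint_left.1 hdis (hPP₀ hsP) hs).exists_notMem
    have hcf : c * f ∈ J := by
      refine hJ.2 fun p hp hpd ↦ ?_
      by_cases hcp : c ∈ p.asIdeal
      · exact Ideal.mul_mem_right _ _ hcp
      · refine Ideal.mul_mem_left _ _ ?_
        by_contra hfp
        exact hpd (hf p (fun x hx ↦ (p.2.mem_or_mem (hJ.1 (hc x hx) p hp hpd)).resolve_left hcp)
          hfp)
    exact (hPp.mem_or_mem (hP.1.2 hcf)).elim hcP hfP

lemma IsLocalization.isFractionOver {A : Type*} [CommRing A] (M : Submonoid A) (hM : 0 ∉ M)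
    {A' : Type*} [CommRing A'] [Algebra A A'] [IsLocalization M A'] (y : A') :
    IsFractionOver A y := by
  obtain ⟨⟨a, s⟩, h⟩ := IsLocalization.surj M y
  exact ⟨s, fun hs ↦ hM (hs ▸ s.2), a, by rw [mul_comm, h]⟩

/-- A central prime disjoint from `M` extends to a central prime of the localization at `M`. -/
lemma IsLocalization.exists_central_comap_eq {A : Type*} [CommRing A] [IsDomain A]
    (M : Submonoid A) (hM : 0 ∉ M) (A' : Type*) [CommRing A'] [IsDomain A'] [Algebra A A']
    [FaithfulSMul A A'] [IsLocalization M A'] {p : PrimeSpectrum A} (hp : p ∈ centralSpectrum A)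
    (hpM : ∀ m ∈ M, m ∉ p.asIdeal) :
    ∃ p' ∈ centralSpectrum A', p'.comap (algebraMap A A') = p := by
  have hdis : Disjoint (M : Set A) p.asIdeal := Set.disjoint_left.2 hpM
  have hcomap := IsLocalization.under_map_of_isPrime_disjoint M A' p.2 hdis
  refine ⟨⟨_, IsLocalization.isPrime_of_isPrime_disjoint M A' p.asIdeal p.2 hdis⟩, ?_,
    PrimeSpectrum.ext hcomap⟩
  refine isCentralIdeal_iff.2 fun y t ht hyt ↦ ?_
  obtain ⟨⟨a, s⟩, ha⟩ := IsLocalization.surj M y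
  obtain ⟨⟨b, r⟩, hb⟩ := IsLocalization.surj M t
  have hb' : algebraMap A A' (b * r * s ^ 2) = t * algebraMap A A' (r * s) ^ 2 := by
    simp only [map_mul, map_pow, ← hb]; ring
  have ha' : algebraMap A A' (a * r) = y * algebraMap A A' (r * s) := by
    simp only [map_mul, ← ha]; ring
  have hT : b * r * s ^ 2 ∈ sumSqCone A := by
    rw [← algebraMap_mem_sumSqCone_iff (C := A') (IsLocalization.isFractionOver M hM), hb']
    exact mul_mem ht (sq_mem_sumSqCone _)
  have hmem : (a * r) ^ 2 + b * r * s ^ 2 ∈ p.asIdeal := by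
    rw [← hcomap, Ideal.mem_comap, map_add, map_pow, ha', hb']
    convert Ideal.mul_mem_left _ (algebraMap A A' (r * s) ^ 2) hyt using 1
    ring
  have har := Ideal.mem_map_of_mem (algebraMap A A') (IsCentralIdeal.mem_of_sq_add hp hT hmem)
  rw [ha'] at har
  exact (Ideal.mul_unit_mem_iff_mem _ (IsLocalization.map_units A' (r * s))).1 har

section LocalizedAt

variable {A : Type*} [CommRing A] {B : Type*} [CommRing B] [Algebra A B]
  (S : Submonoid A) (SA : Type*) [CommRing SA] (SB : Type*) [CommRing SB]
  [Algebra A SA] [Algebra B SB] [Algebra A SB] [Algebra SA SB]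
  [IsScalarTower A SA SB] [IsScalarTower A B SB] [IsLocalization S SA]

lemma Subalgebra.mem_localizedAt {C : Subalgebra A B} {y : SB} :
    y ∈ C.localizedAt S SA SB ↔ ∃ c ∈ C, ∃ s ∈ S, algebraMap A SB s * y = algebraMap B SB c :=
  Iff.rfl

variable {SA SB} in
lemma exists_isIntegral_mul_eq [IsLocalization (Algebra.algebraMapSubmonoid B S) SB]
    (hinj : Function.Injective (algebraMap B SB)) {y : SB} (hy : IsIntegral SA y) :
    ∃ b : B, IsIntegral A b ∧ ∃ s ∈ S, algebraMap A SB s * y = algebraMap B SB b := by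
  obtain ⟨⟨m, hm⟩, hmy⟩ := hy.exists_multiple_integral_of_isLocalization S y
  obtain ⟨⟨b, _, s, hs, rfl⟩, hb⟩ := IsLocalization.surj (Algebra.algebraMapSubmonoid B S) y
  have hsm : algebraMap A SB (s * m) * y = algebraMap B SB (algebraMap A B m * b) := by
    rw [map_mul (algebraMap B SB), ← hb, map_mul, ← IsScalarTower.algebraMap_apply A B SB,
      ← IsScalarTower.algebraMap_apply A B SB]
    ring
  refine ⟨algebraMap A B m * b, ?_, s * m, mul_mem hs hm, hsm⟩
  rw [← isIntegral_algebraMap_iff hinj, ← hsm, map_mul, mul_assoc]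
  have : algebraMap A SB m * y = m • y := (Algebra.smul_def m y).symm
  rw [this]
  exact isIntegral_algebraMap.mul hmy

/-- Integral closures commute with localization. -/
lemma localizedAt_integralClosure [IsLocalization (Algebra.algebraMapSubmonoid B S) SB]
    [FaithfulSMul B SB] :
    (integralClosure A B).localizedAt S SA SB = integralClosure SA SB := by
  ext y
  rw [Subalgebra.mem_localizedAt]
  constructor
  · rintro ⟨c, hc, s, hs, h⟩
    have hc' : IsIntegral SA (algebraMap B SB c) := (IsIntegral.algebraMap hc).tower_top
    obtain ⟨u, hu⟩ := IsLocalization.map_units SA (⟨s, hs⟩ : S)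
    have : y = algebraMap SA SB ↑u⁻¹ * algebraMap B SB c := by
      rw [← h, IsScalarTower.algebraMap_apply A SA SB, ← hu, ← mul_assoc, ← map_mul]
      simp
    rw [this]
    exact isIntegral_algebraMap.mul hc'
  · intro hy
    obtain ⟨b, hb, s, hs, h⟩ :=
      exists_isIntegral_mul_eq S (FaithfulSMul.algebraMap_injective B SB) hy
    exact ⟨b, hb, s, hs, h⟩

variable [IsDomain A] [IsDomain SA] [FaithfulSMul A SA] [FaithfulSMul B SB]

/-- Birational integral closures commute with localization. -/
lemma localizedAt_birationalIntegralClosure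
    [IsLocalization (Algebra.algebraMapSubmonoid B S) SB] :
    (birationalIntegralClosure A B).localizedAt S SA SB = birationalIntegralClosure SA SB := by
  have hSA : Function.Injective (algebraMap A SA) := FaithfulSMul.algebraMap_injective A SA
  have hSB : Function.Injective (algebraMap B SB) := FaithfulSMul.algebraMap_injective B SB
  have h0 : ∀ s ∈ S, s ≠ 0 := by
    rintro _ hs rfl
    simpa using IsLocalization.map_units SA (⟨0, hs⟩ : S)
  ext y
  rw [Subalgebra.mem_localizedAt]
  constructor
  · rintro ⟨c, ⟨hci, a, ha, b, hab⟩, s, hs, h⟩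
    have hy : y ∈ (integralClosure A B).localizedAt S SA SB := ⟨c, hci, s, hs, h⟩
    rw [localizedAt_integralClosure] at hy
    refine ⟨hy, algebraMap A SA (a * s), ?_, algebraMap A SA b, ?_⟩
    · simpa using ⟨ha, h0 s hs⟩
    · rw [← IsScalarTower.algebraMap_apply, ← IsScalarTower.algebraMap_apply,
        map_mul, mul_assoc, h, IsScalarTower.algebraMap_apply A B SB, ← map_mul, hab,
        ← IsScalarTower.algebraMap_apply]
  · rintro ⟨hyi, α, hα, β, hαβ⟩
    obtain ⟨b, hb, s, hs, h⟩ := exists_isIntegral_mul_eq S hSB hyi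
    obtain ⟨⟨a₁, s₁⟩, h₁⟩ := IsLocalization.surj S α
    obtain ⟨⟨a₂, s₂⟩, h₂⟩ := IsLocalization.surj S β
    refine ⟨b, ⟨hb, a₁ * s₂, mul_ne_zero ?_ (h0 _ s₂.2), a₂ * s₁ * s, ?_⟩, s, hs, h⟩
    · rintro rfl
      have hs₁ : algebraMap A SA s₁ ≠ 0 := by simpa using h0 _ s₁.2
      exact mul_ne_zero hα hs₁ (by simpa using h₁)
    · apply hSB
      have h₁' := congrArg (algebraMap SA SB) h₁
      have h₂' := congrArg (algebraMap SA SB) h₂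
      simp only [map_mul, ← IsScalarTower.algebraMap_apply] at h₁' h₂' ⊢
      rw [← h, ← h₁', ← h₂', ← hαβ]
      ring

variable [IsDomain B] [FaithfulSMul A B] [IsDomain SB]

/-- Over a noetherian ring, the ring of elements that are constant on the central fibers
commutes with localization. -/
lemma localizedAt_constantSubalgebra [IsNoetherianRing A]
    [IsLocalization (Algebra.algebraMapSubmonoid B S) SB] :
    (constantSubalgebra A B).localizedAt S SA SB = constantSubalgebra SA SB := by
  have h0 : (0 : A) ∉ S := fun h ↦ by simpa using IsLocalization.map_units SA (⟨0, h⟩ : S)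
  have hB0 : (0 : B) ∉ Algebra.algebraMapSubmonoid B S := by
    rintro ⟨s, hs, h⟩
    exact h0 ((FaithfulSMul.algebraMap_injective A B (h.trans (map_zero _).symm)) ▸ hs)
  have hcomap : ∀ q : PrimeSpectrum SB, (q.comap (algebraMap B SB)).comap (algebraMap A B) =
      (q.comap (algebraMap SA SB)).comap (algebraMap A SA) := by
    intro q
    rw [← PrimeSpectrum.comap_comp_apply, ← PrimeSpectrum.comap_comp_apply,
      ← IsScalarTower.algebraMap_eq, ← IsScalarTower.algebraMap_eq]
  ext y
  rw [Subalgebra.mem_localizedAt, mem_constantSubalgebra]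
  constructor
  · rintro ⟨c, hc, s, hs, h⟩ p hp
    obtain ⟨a, b, hb, hab⟩ := hc (p.comap (algebraMap A SA)) (IsCentralIdeal.comap_algebraMap hp)
    refine ⟨algebraMap A SA a, algebraMap A SA (b * s), fun hbs ↦ ?_, fun q hq hqp ↦ ?_⟩
    · rw [map_mul, Ideal.mul_unit_mem_iff_mem _ (IsLocalization.map_units SA (⟨s, hs⟩ : S))] at hbs
      exact hb hbs
    · have hmem : algebraMap B SB (algebraMap A B b * c - algebraMap A B a) ∈ q.asIdeal :=
        hab (q.comap (algebraMap B SB)) (IsCentralIdeal.comap_algebraMap hq) (by rw [hcomap, hqp])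
      convert hmem using 1
      simp only [map_sub, map_mul, ← h, ← IsScalarTower.algebraMap_apply]
      ring
  · intro hy
    obtain ⟨⟨c, _, s, hs, rfl⟩, h⟩ := IsLocalization.surj (Algebra.algebraMapSubmonoid B S) y
    rw [← IsScalarTower.algebraMap_apply, mul_comm] at h
    obtain ⟨s', hs', hmem⟩ := exists_mul_mem_constantSubalgebra S c (by
      intro p hp hpS
      obtain ⟨p', hp', hpp'⟩ := IsLocalization.exists_central_comap_eq S h0 SA hp hpS
      obtain ⟨α, β, hβ, hαβ⟩ := hy p' hp'
      obtain ⟨⟨a, s₁⟩, h₁⟩ := IsLocalization.surj S α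
      obtain ⟨⟨b, s₂⟩, h₂⟩ := IsLocalization.surj S β
      -- `y` has the value `α / β = s₂ a / (s₁ b)`, so the value of `c = s y` is `s₂ a s / (s₁ b)`
      refine ⟨s₂ * a * s, s₁ * b, ?_, fun q hq hqp ↦ ?_⟩
      · refine fun hmem ↦ (p.2.mem_or_mem hmem).elim (hpS _ s₁.2) fun hbp ↦ hβ ?_
        rw [← hpp'] at hbp
        have hbp : algebraMap A SA b ∈ p'.asIdeal := hbp
        rwa [← h₂, Ideal.mul_unit_mem_iff_mem _ (IsLocalization.map_units SA s₂)] at hbp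
      · obtain ⟨q', hq', rfl⟩ := IsLocalization.exists_central_comap_eq
          (Algebra.algebraMapSubmonoid B S) hB0 SB hq (by
            rintro _ ⟨m, hm, rfl⟩ hmq
            rw [← hqp] at hpS
            exact hpS m hm hmq)
        have hq'p' : q'.comap (algebraMap SA SB) = p' :=
          PrimeSpectrum.localization_comap_injective SA S (by rw [hpp', ← hqp, ← hcomap])
        have hmem := Ideal.mul_mem_left q'.asIdeal
          (algebraMap A SB (s₁ * s₂ * s)) (hαβ q' hq' hq'p')
        change algebraMap B SB _ ∈ q'.asIdeal
        convert hmem using 1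
        have h₁' := congrArg (algebraMap SA SB) h₁
        have h₂' := congrArg (algebraMap SA SB) h₂
        simp only [map_sub, map_mul, ← IsScalarTower.algebraMap_apply] at h₁' h₂' h ⊢
        rw [← h, ← h₁', ← h₂']
        ring)
    refine ⟨algebraMap A B s' * c, hmem, s' * s, mul_mem hs' hs, ?_⟩
    rw [map_mul, mul_assoc, h, map_mul, ← IsScalarTower.algebraMap_apply]

/-- Over a noetherian domain, the central closure commutes with localization. -/
lemma localizedAt_centralClosure [IsNoetherianRing A]
    [IsLocalization (Algebra.algebraMapSubmonoid B S) SB] :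
    (centralClosure A B).localizedAt S SA SB = centralClosure SA SB := by
  have hmem : ∀ y : SB, y ∈ birationalIntegralClosure SA SB ↔
      ∃ c ∈ birationalIntegralClosure A B, ∃ s ∈ S,
        algebraMap A SB s * y = algebraMap B SB c := fun y ↦ by
    rw [← Subalgebra.mem_localizedAt S SA SB, localizedAt_birationalIntegralClosure]
  -- the birational integral closure of `SA` in `SB` is a localization of that of `A` in `B`
  let _ : Algebra (birationalIntegralClosure A B) (birationalIntegralClosure SA SB) :=
    (((algebraMap B SB).comp (birationalIntegralClosure A B).val.toRingHom).codRestrict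
      (birationalIntegralClosure SA SB)
      fun d ↦ (hmem _).2 ⟨d, d.2, 1, one_mem S, by simp⟩).toAlgebra
  have hval : ∀ d : birationalIntegralClosure A B,
      (algebraMap _ (birationalIntegralClosure SA SB) d : SB) = algebraMap B SB d := fun _ ↦ rfl
  have hinj : Function.Injective
      (algebraMap (birationalIntegralClosure A B) (birationalIntegralClosure SA SB)) :=
    fun d d' h ↦
      Subtype.ext (FaithfulSMul.algebraMap_injective B SB (congrArg Subtype.val h))
  have : FaithfulSMul (birationalIntegralClosure A B) (birationalIntegralClosure SA SB) :=
    (faithfulSMul_iff_algebraMap_injective _ _).2 hinj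
  have : IsScalarTower A (birationalIntegralClosure A B) (birationalIntegralClosure SA SB) :=
    .of_algebraMap_eq fun a ↦ Subtype.ext (IsScalarTower.algebraMap_apply A B SB a)
  have : IsLocalization (Algebra.algebraMapSubmonoid (birationalIntegralClosure A B) S)
      (birationalIntegralClosure SA SB) := by
    refine ⟨⟨?_, fun y ↦ ?_, fun {d d'} h ↦ ⟨1, by rw [hinj h]⟩⟩⟩
    · rintro ⟨_, s, hs, rfl⟩
      rw [← IsScalarTower.algebraMap_apply, IsScalarTower.algebraMap_apply A SA]
      exact (IsLocalization.map_units SA (⟨s, hs⟩ : S)).map _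
    · obtain ⟨d, hd, s, hs, h⟩ := (hmem y).1 y.2
      refine ⟨⟨⟨d, hd⟩, ⟨_, s, hs, rfl⟩⟩, Subtype.ext ?_⟩
      change y * algebraMap B SB (algebraMap A B s) = algebraMap B SB d
      rw [← h, ← IsScalarTower.algebraMap_apply, mul_comm]
  have key := localizedAt_constantSubalgebra (B := birationalIntegralClosure A B) S SA
    (birationalIntegralClosure SA SB)
  rw [centralClosure, centralClosure, ← key]
  ext y
  constructor
  · rintro ⟨_, ⟨d, hd, rfl⟩, s, hs, h⟩
    exact ⟨⟨y, (hmem y).2 ⟨d, d.2, s, hs, h⟩⟩, ⟨d, hd, s, hs, Subtype.ext h⟩, rfl⟩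
  · rintro ⟨y, ⟨d, hd, s, hs, h⟩, rfl⟩
    exact ⟨d, ⟨d, hd, rfl⟩, s, hs, congrArg Subtype.val h⟩

end LocalizedAt

/-! ### Localization of the central seminormalization -/

section Main

variable {A : Type*} [CommRing A] [IsDomain A] {B : Type*} [CommRing B] [IsDomain B]
  [Algebra A B] [FaithfulSMul A B]

/-- The central seminormalization commutes with localization over a noetherian domain. -/
lemma centralSeminormalization_localization [IsNoetherianRing A] (S : Submonoid A)
    (h0 : (0 : A) ∉ S)
    (SA : Type*) [CommRing SA] (SB : Type*) [CommRing SB]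
    [Algebra A SA] [Algebra B SB] [Algebra A SB] [Algebra SA SB]
    [IsScalarTower A SA SB] [IsScalarTower A B SB]
    [IsLocalization S SA] [IsLocalization (Algebra.algebraMapSubmonoid B S) SB] :
    IsGreatest (centrallySubintegralSubextensions SA SB) (centralSeminormalization SA SB) ∧
      (centralSeminormalization A B).localizedAt S SA SB = centralSeminormalization SA SB := by
  have hinj := FaithfulSMul.algebraMap_injective A B
  have hS : S ≤ nonZeroDivisors A := le_nonZeroDivisors_of_noZeroDivisors h0
  have hS' : Algebra.algebraMapSubmonoid B S ≤ nonZeroDivisors B :=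
    algebraMapSubmonoid_le_nonZeroDivisors_of_faithfulSMul B hS
  have : IsDomain SA := IsLocalization.isDomain_of_le_nonZeroDivisors SA hS
  have : IsDomain SB := IsLocalization.isDomain_of_le_nonZeroDivisors SB hS'
  have : FaithfulSMul A SA :=
    (faithfulSMul_iff_algebraMap_injective A SA).2 (IsLocalization.injective SA hS)
  have : FaithfulSMul B SB :=
    (faithfulSMul_iff_algebraMap_injective B SB).2 (IsLocalization.injective SB hS')
  have : FaithfulSMul SA SB := by
    rw [faithfulSMul_iff_algebraMap_injective, injective_iff_map_eq_zero]
    intro x hx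
    obtain ⟨⟨a, s⟩, h⟩ := IsLocalization.surj S x
    have h1 := congrArg (algebraMap SA SB) h
    rw [map_mul, hx, zero_mul, ← IsScalarTower.algebraMap_apply,
      IsScalarTower.algebraMap_apply A B SB] at h1
    have ha : a = 0 := by simpa using h1.symm
    rw [ha, map_zero] at h
    exact ((IsLocalization.map_units SA s).mul_left_eq_zero).1 h
  refine ⟨isGreatest_centralSeminormalization SA SB, ?_⟩
  have hone : (-1 : SA) ∈ sumSqCone SA ↔ (-1 : A) ∈ sumSqCone A := by
    rw [← algebraMap_mem_sumSqCone_iff (C := SA) (IsLocalization.isFractionOver S h0),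
      map_neg, map_one]
  by_cases hA : (-1 : A) ∈ sumSqCone A
  · rw [centralSeminormalization_eq_integralClosure hA,
      centralSeminormalization_eq_integralClosure (hone.2 hA), localizedAt_integralClosure]
  · rw [centralSeminormalization_eq_centralClosure hA,
      centralSeminormalization_eq_centralClosure (hone.not.2 hA), localizedAt_centralClosure]

/-- Inside the fraction field of `B`, an intermediate ring is the intersection of its
localizations at the primes of `A`. -/
lemma image_eq_iInter_localizedAt (C : Subalgebra A B) :
    algebraMap B (FractionRing B) '' (C : Set B) =
      ⋂ p : PrimeSpectrum A, localizationAtPrimeToFractionRing B p.asIdeal ''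
        (C.localizedAt p.asIdeal.primeCompl (Localization.AtPrime p.asIdeal)
          (Localization (Algebra.algebraMapSubmonoid B p.asIdeal.primeCompl)) : Set _) := by
  have hmap : ∀ (p : PrimeSpectrum A) (b : B), localizationAtPrimeToFractionRing B p.asIdeal
      (algebraMap B _ b) = algebraMap B (FractionRing B) b := fun p b ↦ by
    exact IsLocalization.map_eq _ b
  ext z
  simp only [Set.mem_iInter, Set.mem_image, SetLike.mem_coe]
  constructor
  · rintro ⟨c, hc, rfl⟩ p
    exact ⟨algebraMap B _ c, ⟨c, hc, 1, one_mem _, by simp⟩, hmap p c⟩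
  · intro h
    -- the ideal of denominators of `z` is contained in no prime ideal
    let I : Ideal A :=
      { carrier := {a | ∃ c ∈ C, algebraMap B (FractionRing B) (algebraMap A B a) * z =
          algebraMap B (FractionRing B) c}
        zero_mem' := ⟨0, zero_mem C, by simp⟩
        add_mem' := by
          rintro a a' ⟨c, hc, hac⟩ ⟨c', hc', hac'⟩
          exact ⟨c + c', add_mem hc hc', by simp only [map_add, add_mul, hac, hac']⟩
        smul_mem' := by
          rintro r a ⟨c, hc, hac⟩
          exact ⟨algebraMap A B r * c, mul_mem (C.algebraMap_mem r) hc, by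
            simp only [smul_eq_mul, map_mul, mul_assoc, hac]⟩ }
    have hI : I = ⊤ := by
      by_contra hI
      obtain ⟨m, hm, hIm⟩ := Ideal.exists_le_maximal I hI
      obtain ⟨y, ⟨c, hc, s, hs, hsy⟩, rfl⟩ := h ⟨m, hm.isPrime⟩
      refine hs (hIm ⟨c, hc, ?_⟩)
      rw [← hmap ⟨m, hm.isPrime⟩, ← hmap ⟨m, hm.isPrime⟩, ← hsy, map_mul,
        IsScalarTower.algebraMap_apply A B (Localization _)]
    obtain ⟨c, hc, h1⟩ := (Ideal.eq_top_iff_one I).1 hI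
    exact ⟨c, hc, by simpa using h1.symm⟩

end Main

theorem theorem7p2 {A : Type u} [CommRing A] [IsDomain A] [Algebra ℚ A] [IsNagataRing A]
    {B : Type v} [CommRing B] [IsDomain B] [Algebra A B] [FaithfulSMul A B]
    [Algebra.EssFiniteType A B] :
    -- the central seminormalization of `A` in `B` exists (it is even the greatest element)
    IsGreatest (centrallySubintegralSubextensions A B) (centralSeminormalization A B) ∧
    -- it commutes with localization at an arbitrary multiplicative subset `S` of `A`
    (∀ (S : Submonoid A), (0 : A) ∉ S →
      ∀ (SA : Type w) [CommRing SA] (SB : Type x) [CommRing SB]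
        [Algebra A SA] [Algebra B SB] [Algebra A SB] [Algebra SA SB]
        [IsScalarTower A SA SB] [IsScalarTower A B SB]
        [IsLocalization S SA] [IsLocalization (Algebra.algebraMapSubmonoid B S) SB],
        IsGreatest (centrallySubintegralSubextensions SA SB) (centralSeminormalization SA SB) ∧
        (centralSeminormalization A B).localizedAt S SA SB = centralSeminormalization SA SB) ∧
    -- in particular it commutes with localization at the prime ideals of `A`
    (∀ (p : Ideal A) [p.IsPrime],
      (centralSeminormalization A B).localizedAt p.primeCompl (Localization.AtPrime p)
          (Localization (Algebra.algebraMapSubmonoid B p.primeCompl)) =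
        centralSeminormalization (Localization.AtPrime p)
          (Localization (Algebra.algebraMapSubmonoid B p.primeCompl))) ∧
    -- inside the fraction field of `B` it is the intersection of the local seminormalizations
    algebraMap B (FractionRing B) '' (centralSeminormalization A B : Set B) =
      ⋂ p : PrimeSpectrum A, localizationAtPrimeToFractionRing B p.asIdeal ''
        (centralSeminormalization (Localization.AtPrime p.asIdeal)
          (Localization (Algebra.algebraMapSubmonoid B p.asIdeal.primeCompl)) : Set _) := by
  have hloc := fun (p : Ideal A) [p.IsPrime] ↦
    (centralSeminormalization_localization (B := B) p.primeCompl (fun h ↦ h p.zero_mem)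
      (Localization.AtPrime p) (Localization (Algebra.algebraMapSubmonoid B p.primeCompl))).2
  refine ⟨isGreatest_centralSeminormalization A B, ?_, hloc, ?_⟩
  · intro S h0 SA _ SB _ _ _ _ _ _ _ _ _
    exact centralSeminormalization_localization S h0 SA SB
  · rw [image_eq_iInter_localizedAt]
    simp only [hloc]
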